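/- Let $n\ge 2$, let $0<a_1\le\dots\le a_n$ be real numbers, $A=\mathrm{diag}(a_1,\dots,a_n)$, and let \[ E(A)=\Big\{z\in\mathbb C^n \;\Big|\; \tfrac{|z_1|^2}{a_1}+\dots+\tfrac{|z_n|^2}{a_n}=1\Big\} \] be the complex ellipsoid, with the Riemannian metric $g$ given by the restriction of the Euclidean metric $\mathrm{Re}\langle\cdot,\cdot\rangle$ of $\mathbb C^n$ and the one-form $\alpha_z(w)=\tfrac12\mathrm{Re}\langle \mathrm i z,w\rangle$ restricted to $E(A)$. Equip $TE(A)$ with the twisted symplectic form $\omega_{d\alpha}=d\lambda-\pi^*d\alpha$, where $\pi:TE(A)\to E(A)$ is the projection and $\lambda_{(q,v)}(\xi)=g_q(v,d\pi\,\xi)$, and for $\kappa>0$ let \[ \Sigma_\kappa=\{(q,v)\in TE(A)\mid \tfrac12 g_q(v,v)=\kappa\}, \] a closed hypersurface of dimension $4n-3$. Call $\Sigma_\kappa$ of contact type if there is a smooth one-form $\beta$ on $\Sigma_\kappa$ such that $d\beta=\omega_{d\alpha}|_{\Sigma_\kappa}$ and $\beta\wedge(d\beta)^{2n-2}$ vanishes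 nowhere on $\Sigma_\kappa$. Then for every $\kappa\in(0,\tfrac{a_n}{8}]$ the energy surface $\Sigma_\kappa$ is not of contact type. -/

import Mathlib

open scoped ContDiff Topology

noncomputable section

namespace MagneticEllipsoid

section Forms

variable {V : Type*} [NormedAddCommGroup V] [NormedSpace ℝ V]

/-- The tangent space at `p` of an embedded submanifold `N` of the vector space `V`: the set of
velocities `γ'(0)` of smooth curves `γ` in `N` with `γ(0) = p`. -/
def tangentSpaceAt (N : Set V) (p : V) : Set V :=
  {w | ∃ γ : ℝ → V, ContDiffAt ℝ ∞ γ 0 ∧ γ 0 = p ∧ (∀ᶠ t in 𝓝 0, γ t ∈ N) ∧ HasDerivAt γ w 0}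

/-- The tangent bundle `TN = {(q, v) : q ∈ N, v ∈ T_q N}` as a subset of `V × V`. -/
def tangentBundle (N : Set V) : Set (V × V) :=
  {x | x.1 ∈ N ∧ x.2 ∈ tangentSpaceAt N x.1}

/-- The exterior derivative `(dθ)_p(u, v)` of a one-form `θ`. -/
def extD (θ : V → V →L[ℝ] ℝ) (p u v : V) : ℝ :=
  extDeriv (fun x => ContinuousAlternatingMap.ofSubsingleton ℝ V ℝ (0 : Fin 1) (θ x)) p ![u, v]

/-- The value of the `(2m+1)`-form `β ∧ τ^m` on the vectors `w 0, …, w (2m)`, for a linear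
functional `β` and an alternating bilinear form `τ`. -/
def wedgePow (m : ℕ) (β : V →L[ℝ] ℝ) (τ : V → V → ℝ) (w : Fin (2 * m + 1) → V) : ℝ :=
  (1 / 2 ^ m) * ∑ s : Equiv.Perm (Fin (2 * m + 1)), ((Equiv.Perm.sign s : ℤ) : ℝ) *
    (β (w (s 0)) * ∏ i : Fin m,
      τ (w (s ⟨2 * (i : ℕ) + 1, by omega⟩)) (w (s ⟨2 * (i : ℕ) + 2, by omega⟩)))

/-- `β` restricts to a contact form on the submanifold `N` of dimension `2m+1`: the form
`β ∧ (dβ)^m` vanishes at no point of `N` as a form on the tangent space of `N`. -/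
def IsContactFormOn (N : Set V) (m : ℕ) (β : V → V →L[ℝ] ℝ) : Prop :=
  ∀ p ∈ N, ∃ w : Fin (2 * m + 1) → V,
    (∀ i, w i ∈ tangentSpaceAt N p) ∧ wedgePow m (β p) (extD β p) w ≠ 0

/-- The hypersurface `N`, of dimension `2m+1`, of a symplectic manifold with symplectic form `Ω`
is of contact type: there is a contact form on `N` whose exterior derivative is the restriction of
`Ω` to `N`. The smooth one-forms on the embedded submanifold `N` are the restrictions to `TN` of
smooth one-forms `β` on open neighbourhoods `U` of `N` in `V`, and restriction commutes with the
exterior derivative. -/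
def IsOfContactType (N : Set V) (m : ℕ) (Ω : V → V → V → ℝ) : Prop :=
  ∃ (U : Set V) (β : V → V →L[ℝ] ℝ), IsOpen U ∧ N ⊆ U ∧ ContDiffOn ℝ ∞ β U ∧
    (∀ p ∈ N, ∀ u ∈ tangentSpaceAt N p, ∀ v ∈ tangentSpaceAt N p, extD β p u v = Ω p u v) ∧
    IsContactFormOn N m β

theorem extD_apply {θ : V → V →L[ℝ] ℝ} {p : V} (h : DifferentiableAt ℝ θ p) (u v : V) :
    extD θ p u v = fderiv ℝ θ p u v - fderiv ℝ θ p v u := by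
  have h' : DifferentiableAt ℝ
      (fun x => ContinuousAlternatingMap.ofSubsingleton ℝ V ℝ (0 : Fin 1) (θ x)) p :=
    (ContinuousAlternatingMap.ofSubsingletonLIE (𝕜 := ℝ) (E := V) (F := ℝ) (0 : Fin 1)).differentiableAt.comp p h
  have key : ∀ w : V, fderiv ℝ (fun x => θ x w) p = (fderiv ℝ θ p).flip w := by
    intro w
    ext y
    simp [fderiv_clm_apply h (differentiableAt_const w)]
  rw [extD, extDeriv_apply h']
  simp [Fin.sum_univ_two, Fin.removeNth, key]
  ring

end Forms

section Magnetic

variable {V : Type*} [NormedAddCommGroup V] [InnerProductSpace ℝ V]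

/-- The Liouville form on the tangent bundle, `λ_{(q,v)}(ξ) = g_q(v, dπ ξ)`, for the metric `g`
induced by the inner product of `V`. -/
def liouvilleForm (x : V × V) : (V × V) →L[ℝ] ℝ :=
  (innerSL ℝ x.2).comp (ContinuousLinearMap.fst ℝ V V)

/-- The twisted symplectic form `ω_{dα} = dλ - π^* dα`, to be restricted to the tangent spaces of
the tangent bundle of a submanifold of `V`. -/
def twistedForm (α : V → V →L[ℝ] ℝ) (x ξ η : V × V) : ℝ :=
  extD liouvilleForm x ξ η - extD α x.1 ξ.1 η.1

/-- The energy surface `E⁻¹(κ) ⊆ TM` of the kinetic energy `E(q,v) = ½ g_q(v,v)`. -/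
def energySurface (M : Set V) (κ : ℝ) : Set (V × V) :=
  {x | x ∈ tangentBundle M ∧ (1 / 2) * inner ℝ x.2 x.2 = κ}

end Magnetic

variable {n : ℕ}

/-- The complex ellipsoid `E(A)`, `A = diag(a_1, …, a_n)`. -/
def ellipsoid (a : Fin n → ℝ) : Set (EuclideanSpace ℂ (Fin n)) :=
  {z | ∑ i, ‖z i‖ ^ 2 / a i = 1}

/-- The magnetic potential `α_z(w) = ½ Re⟨i z, w⟩`. -/
def magneticPotential (z : EuclideanSpace ℂ (Fin n)) : EuclideanSpace ℂ (Fin n) →L[ℝ] ℝ :=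
  (1 / 2 : ℝ) • innerSL ℝ (Complex.I • z)

theorem magneticPotential_apply (z w : EuclideanSpace ℂ (Fin n)) :
    magneticPotential z w = 1 / 2 * (∑ i, starRingEnd ℂ (z i) * w i).im := by
  simp [magneticPotential, PiLp.inner_apply, Complex.inner, Complex.mul_im,
    Finset.sum_add_distrib]
  simp only [mul_comm, sub_eq_add_neg]

end MagneticEllipsoid

end

open scoped ContDiff Topology

noncomputable section

/-! Let `β` be a contact form with `dβ = ω_{dα}` on the energy surface. The magnetic geodesic field
`X` spans a kernel direction of the twisted form there, so `β(X)` has no zero: where `β(X) = 0`, the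
top form `β ∧ (dβ)^m` would vanish (`wedgePow_eq_zero`, `apply_magneticField_ne_zero`).

Put `r = √a_n` and `s = √(2κ)`. The circle of radius `r` on the last axis, run with speed `s` in
either direction, is a magnetic geodesic. Each of the two lifts bounds a disc inside the energy
surface (`discMap`), and `β - (λ - π^*α)` is closed, hence exact along the disc. So the mean of
`β(X)` over the lift is that of `(λ - π^*α)(X)`, namely `s² - sr/2` for the positive direction and
`s² + sr/2` for the negative one (`exists_apply_magneticField_eq`).

The condition `κ ≤ a_n/8` says precisely `s ≤ r/2`, which makes the first mean nonpositive, while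
the second is positive. Turning the velocity from one direction to the other through a second axis
(`circleFamily`) joins the two lifts within the energy surface, so `β(X)` has a zero, a
contradiction. -/

namespace MagneticEllipsoid

/-! ### Linear algebra of `b ∧ B^m` -/

section Wedge

variable {V : Type*} [AddCommGroup V] [Module ℝ V]

/-- The multilinear form `w ↦ b (w 0) * ∏ i, B (w (2i+1)) (w (2i+2))`. -/
def wedgeMultilinear (m : ℕ) (b : V →ₗ[ℝ] ℝ) (B : V →ₗ[ℝ] V →ₗ[ℝ] ℝ) :
    MultilinearMap ℝ (fun _ : Fin (2 * m + 1) => V) ℝ :=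
  MultilinearMap.mk' (fun w => b (w 0) * ∏ i : Fin m,
      B (w ⟨2 * (i : ℕ) + 1, by omega⟩) (w ⟨2 * (i : ℕ) + 2, by omega⟩))
    (by
      intro w k x y
      by_cases hk : k = 0
      · subst hk
        simp [Fin.ext_iff, add_mul]
      -- A slot other than `0` belongs to exactly one pair `(2i+1, 2i+2)`, so a single factor of the
      -- product changes.
      · obtain ⟨i, hi⟩ : ∃ i : Fin m, (k : ℕ) = 2 * i + 1 ∨ (k : ℕ) = 2 * i + 2 := by
          have := Fin.val_ne_of_ne hk
          simp only [Fin.val_zero] at this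
          exact ⟨⟨((k : ℕ) - 1) / 2, by omega⟩, by simp only; omega⟩
        have h0 : ∀ z, Function.update w k z 0 = w 0 := fun z =>
          Function.update_of_ne (Ne.symm hk) _ _
        have hne : ∀ z, ∀ j ∈ Finset.univ.erase i,
            B (Function.update w k z ⟨2 * (j : ℕ) + 1, by omega⟩)
              (Function.update w k z ⟨2 * (j : ℕ) + 2, by omega⟩) =
            B (w ⟨2 * (j : ℕ) + 1, by omega⟩) (w ⟨2 * (j : ℕ) + 2, by omega⟩) := by
          intro z j hj
          have hj' : (j : ℕ) ≠ i := fun h => (Finset.mem_erase.1 hj).1 (Fin.ext h)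
          rw [Function.update_of_ne, Function.update_of_ne] <;>
            simp only [ne_eq, Fin.ext_iff] <;> omega
        simp only [h0, ← Finset.mul_prod_erase _ _ (Finset.mem_univ i),
          Finset.prod_congr rfl (hne _)]
        rcases hi with hi | hi <;>
          simp [Function.update_apply, Fin.ext_iff, hi] <;> ring)
    (by
      intro w k c x
      by_cases hk : k = 0
      · subst hk
        simp [Fin.ext_iff, mul_assoc]
      · obtain ⟨i, hi⟩ : ∃ i : Fin m, (k : ℕ) = 2 * i + 1 ∨ (k : ℕ) = 2 * i + 2 := by
          have := Fin.val_ne_of_ne hk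
          simp only [Fin.val_zero] at this
          exact ⟨⟨((k : ℕ) - 1) / 2, by omega⟩, by simp only; omega⟩
        have h0 : ∀ z, Function.update w k z 0 = w 0 := fun z =>
          Function.update_of_ne (Ne.symm hk) _ _
        have hne : ∀ z, ∀ j ∈ Finset.univ.erase i,
            B (Function.update w k z ⟨2 * (j : ℕ) + 1, by omega⟩)
              (Function.update w k z ⟨2 * (j : ℕ) + 2, by omega⟩) =
            B (w ⟨2 * (j : ℕ) + 1, by omega⟩) (w ⟨2 * (j : ℕ) + 2, by omega⟩) := by
          intro z j hj
          have hj' : (j : ℕ) ≠ i := fun h => (Finset.mem_erase.1 hj).1 (Fin.ext h)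
          rw [Function.update_of_ne, Function.update_of_ne] <;>
            simp only [ne_eq, Fin.ext_iff] <;> omega
        simp only [h0, ← Finset.mul_prod_erase _ _ (Finset.mem_univ i),
          Finset.prod_congr rfl (hne _)]
        rcases hi with hi | hi <;>
          simp [Function.update_apply, Fin.ext_iff, hi] <;> ring)

theorem wedgeMultilinear_apply (m : ℕ) (b : V →ₗ[ℝ] ℝ) (B : V →ₗ[ℝ] V →ₗ[ℝ] ℝ)
    (w : Fin (2 * m + 1) → V) :
    wedgeMultilinear m b B w = b (w 0) * ∏ i : Fin m,
      B (w ⟨2 * (i : ℕ) + 1, by omega⟩) (w ⟨2 * (i : ℕ) + 2, by omega⟩) := rfl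

/-- The form vanishes as soon as one argument is annihilated by `b` and pairs to zero with all
arguments under `B`. -/
theorem wedgeMultilinear_eq_zero {m : ℕ} {b : V →ₗ[ℝ] ℝ} {B : V →ₗ[ℝ] V →ₗ[ℝ] ℝ}
    {w : Fin (2 * m + 1) → V} (k : Fin (2 * m + 1)) (hb : b (w k) = 0)
    (hl : ∀ i, B (w k) (w i) = 0) (hr : ∀ i, B (w i) (w k) = 0) :
    wedgeMultilinear m b B w = 0 := by
  rw [wedgeMultilinear_apply]
  by_cases hk : k = 0
  · rw [← hk, hb, zero_mul]
  · have := Fin.val_ne_of_ne hk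
    simp only [Fin.val_zero] at this
    refine mul_eq_zero_of_right _ (Finset.prod_eq_zero
      (Finset.mem_univ (⟨((k : ℕ) - 1) / 2, by omega⟩ : Fin m)) ?_)
    rcases Nat.even_or_odd' (k : ℕ) with ⟨c, hc | hc⟩
    · convert hr _ using 3
      ext
      simp only
      omega
    · convert hl _ using 3
      · congr 1
        ext
        simp only
        omega

end Wedge

section

variable {V : Type*} [NormedAddCommGroup V] [NormedSpace ℝ V]

/-- The sum over permutations in `wedgePow` is an alternatization, which makes the vanishing and
expansion rules of alternating maps available. -/
theorem wedgePow_eq_alternatization (m : ℕ) (b : V →L[ℝ] ℝ) (B : V →ₗ[ℝ] V →ₗ[ℝ] ℝ)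
    (w : Fin (2 * m + 1) → V) :
    wedgePow m b (fun u v => B u v) w =
      (1 / 2 ^ m) * MultilinearMap.alternatization (wedgeMultilinear m (b : V →ₗ[ℝ] ℝ) B) w := by
  rw [wedgePow, MultilinearMap.alternatization_apply]
  congr 1
  refine Finset.sum_congr rfl fun s _ => ?_
  rw [MultilinearMap.domDomCongr_apply, wedgeMultilinear_apply, Units.smul_def, zsmul_eq_mul]
  rfl

/-- If `w` consists of `2m+1` vectors of a subspace `W` with `dim W ≤ 2m+1`, and a nonzero vector
`X ∈ W` lies in the kernels of `b` and of `B` on the vectors `w i`, then `b ∧ B^m` vanishes on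
`w`. -/
theorem wedgePow_eq_zero {m : ℕ} {b : V →L[ℝ] ℝ} {B : V →ₗ[ℝ] V →ₗ[ℝ] ℝ}
    (hB : ∀ u v, B u v = -B v u) {W : Submodule ℝ V} [FiniteDimensional ℝ W]
    (hW : Module.finrank ℝ W ≤ 2 * m + 1) {w : Fin (2 * m + 1) → V} (hw : ∀ i, w i ∈ W)
    {X : V} (hXW : X ∈ W) (hX : X ≠ 0) (hb : b X = 0)
    (hBX : X ∈ Submodule.span ℝ (Set.range w) → ∀ i, B X (w i) = 0) :
    wedgePow m b (fun u v => B u v) w = 0 := by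
  rw [wedgePow_eq_alternatization]
  refine mul_eq_zero_of_right _ ?_
  -- A dependent family is killed by any alternating map. An independent one spans `W` by the
  -- dimension bound, so `X` is a combination of the `w i` and `hBX` applies.
  by_cases hli : LinearIndependent ℝ w
  swap
  · exact AlternatingMap.map_linearDependent _ _ hli
  have hle : Submodule.span ℝ (Set.range w) ≤ W :=
    Submodule.span_le.2 (by rintro _ ⟨i, rfl⟩; exact hw i)
  have hspan : Submodule.span ℝ (Set.range w) = W := by
    refine Submodule.eq_of_le_of_finrank_le hle ?_
    rw [finrank_span_eq_card hli, Fintype.card_fin]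
    exact hW
  have hXs : X ∈ Submodule.span ℝ (Set.range w) := hspan ▸ hXW
  have hl := hBX hXs
  obtain ⟨c, rfl⟩ := (Submodule.mem_span_range_iff_exists_fun ℝ).1 hXs
  obtain ⟨k, hk⟩ : ∃ k, c k ≠ 0 := by
    by_contra! h
    exact hX (by simp [h])
  set X := ∑ i, c i • w i with hXdef
  have hXX : B X X = 0 := by
    have := hB X X
    linarith
  -- Every summand vanishes once `X` replaces `w k`, since `X` then sits in slot `s.symm k`.
  -- Expanding `X = ∑ c i • w i` in slot `k` leaves only `c k` times the original value, and `c k ≠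
  -- 0`.
  have key : MultilinearMap.alternatization (wedgeMultilinear m (b : V →ₗ[ℝ] ℝ) B)
      (Function.update w k X) = 0 := by
    rw [MultilinearMap.alternatization_apply]
    refine Finset.sum_eq_zero fun s _ => ?_
    rw [MultilinearMap.domDomCongr_apply, wedgeMultilinear_eq_zero (s.symm k), smul_zero]
    · simpa using hb
    · intro i
      by_cases h : s i = k
      · simpa [h] using hXX
      · simpa [Function.update_of_ne h] using hl (s i)
    · intro i
      rw [hB, neg_eq_zero]
      by_cases h : s i = k
      · simpa [h] using hXX
      · simpa [Function.update_of_ne h] using hl (s i)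
  rw [hXdef, AlternatingMap.map_update_sum, Finset.sum_eq_single k] at key
  · rw [AlternatingMap.map_update_smul, Function.update_eq_self] at key
    exact (smul_eq_zero.1 key).resolve_left hk
  · intro i _ hik
    rw [AlternatingMap.map_update_smul, AlternatingMap.map_update_self _ _ hik.symm, smul_zero]
  · simp

end

/-! ### Pullback of one-forms and the Poincaré lemma -/

section Forms

variable {V : Type*} [NormedAddCommGroup V] [NormedSpace ℝ V]
  {E : Type*} [NormedAddCommGroup E] [NormedSpace ℝ E]

theorem two_le_smooth : (2 : WithTop ℕ∞) ≤ ∞ := by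
  exact WithTop.coe_le_coe.2 le_top

/-- The differential of a smooth map into `N` takes values in the tangent spaces of `N`. -/
theorem fderiv_mem_tangentSpaceAt {N : Set V} {F : E → V} (hF : ContDiff ℝ ∞ F)
    (hFN : ∀ z, F z ∈ N) (z x : E) : fderiv ℝ F z x ∈ tangentSpaceAt N (F z) := by
  refine ⟨fun t => F (z + t • x), (hF.comp (by fun_prop)).contDiffAt, by simp,
    Filter.Eventually.of_forall fun t => hFN _, ?_⟩
  have h1 : HasDerivAt (fun t : ℝ => z + t • x) x 0 := by
    simpa using ((hasDerivAt_id (0 : ℝ)).smul_const x).const_add z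
  have h2 : HasFDerivAt F (fderiv ℝ F z) (z + (0 : ℝ) • x) := by
    simpa using (hF.differentiable (by simp) z).hasFDerivAt
  exact h2.comp_hasDerivAt (0 : ℝ) h1

/-- The exterior derivative of one-forms commutes with pullback. -/
theorem extD_pullback {θ : V → V →L[ℝ] ℝ} {F : E → V} {z : E}
    (hθ : DifferentiableAt ℝ θ (F z)) (hF : ContDiff ℝ ∞ F) (x y : E) :
    extD (fun z => (θ (F z)).comp (fderiv ℝ F z)) z x y =
      extD θ (F z) (fderiv ℝ F z x) (fderiv ℝ F z y) := by
  have hω : DifferentiableAt ℝ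
      (fun x => ContinuousAlternatingMap.ofSubsingleton ℝ V ℝ (0 : Fin 1) (θ x)) (F z) :=
    (ContinuousAlternatingMap.ofSubsingletonLIE (𝕜 := ℝ) (E := V) (F := ℝ)
      (0 : Fin 1)).differentiableAt.comp _ hθ
  have h := extDeriv_pullback (r := ∞) hω hF.contDiffAt (by simpa using two_le_smooth)
  have h2 := congrArg (fun ψ => ψ ![x, y]) h
  simp only [ContinuousAlternatingMap.compContinuousLinearMap_apply] at h2
  rw [extD, extD]
  have hv : ![fderiv ℝ F z x, fderiv ℝ F z y] = fderiv ℝ F z ∘ ![x, y] :=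
    funext fun i => by fin_cases i <;> rfl
  rw [hv, ← h2]
  rfl

/-- If two one-forms have the same exterior derivative on the submanifold `N`, then the pullback of
their difference by a smooth map from a normed space into `N` is exact. -/
theorem exists_primitive_pullback {N U : Set V} {β θ : V → V →L[ℝ] ℝ} (hU : IsOpen U)
    (hNU : N ⊆ U) (hβ : ContDiffOn ℝ ∞ β U) (hθ : ContDiff ℝ ∞ θ)
    (h : ∀ p ∈ N, ∀ u ∈ tangentSpaceAt N p, ∀ v ∈ tangentSpaceAt N p,
      extD β p u v = extD θ p u v) {F : E → V} (hF : ContDiff ℝ ∞ F) (hFN : ∀ z, F z ∈ N) :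
    ∃ f : E → ℝ, ∀ z, HasFDerivAt f ((β (F z) - θ (F z)).comp (fderiv ℝ F z)) z := by
  have hβd : ∀ p ∈ N, ContDiffAt ℝ ∞ β p := fun p hp => hβ.contDiffAt (hU.mem_nhds (hNU hp))
  have hd : Differentiable ℝ (fun z => (β (F z) - θ (F z)).comp (fderiv ℝ F z)) := by
    intro z
    refine DifferentiableAt.clm_comp ?_ ?_
    · exact DifferentiableAt.sub
        (((hβd _ (hFN z)).differentiableAt (by simp)).comp z (hF.differentiable (by simp) z))
        ((hθ.differentiable (by simp) _).comp z (hF.differentiable (by simp) z))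
    · exact (hF.fderiv_right (m := 1) (by simpa [one_add_one_eq_two] using two_le_smooth)).differentiable (by simp) z
  -- Poincaré lemma on the whole space: closedness of a one-form is symmetry of its derivative. The
  -- pullback is closed because the differential of `F` lands in the tangent spaces of `N`, where
  -- the exterior derivatives agree.
  obtain ⟨f, hf⟩ := convex_univ.exists_forall_hasFDerivAt_of_fderiv_symmetric isOpen_univ
    hd.differentiableOn (fun z _ x y => by
      have hb := (hβd _ (hFN z)).differentiableAt (by simp)
      have ht := hθ.differentiable (by simp) (F z)
      have hs := hb.fun_sub ht
      have h1 := extD_pullback hs hF x y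
      have h2 := h _ (hFN z) _ (fderiv_mem_tangentSpaceAt hF hFN z x) _
        (fderiv_mem_tangentSpaceAt hF hFN z y)
      rw [extD_apply (hd z), extD_apply hs, fderiv_fun_sub hb ht] at h1
      rw [extD_apply hb, extD_apply ht] at h2
      simp only [sub_apply] at h1
      linarith)
  exact ⟨f, fun z => hf z (Set.mem_univ z)⟩

end Forms

/-! ### Energy surfaces over quadrics and the magnetic geodesic field -/

section Quadric

variable {V : Type*} [NormedAddCommGroup V] [InnerProductSpace ℝ V]

/-- The unit level set of the quadratic form of `D`. -/
def quadric (D : V →L[ℝ] V) : Set V :=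
  {z | inner ℝ (D z) z = 1}

theorem mem_tangentSpaceAt_quadric {D : V →L[ℝ] V} (hD : ∀ x y, inner ℝ (D x) y = inner ℝ x (D y))
    {p : V} (hp : p ∈ quadric D) (w : V) :
    w ∈ tangentSpaceAt (quadric D) p ↔ inner ℝ (D p) w = 0 := by
  constructor
  · rintro ⟨γ, -, h0, hN, hγ⟩
    have h1 : HasDerivAt (fun t => inner ℝ (D (γ t)) (γ t)) (inner ℝ (D (γ 0)) w + inner ℝ (D w) (γ 0)) 0 :=
      (D.hasFDerivAt.comp_hasDerivAt (0 : ℝ) hγ).inner ℝ hγ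
    have h2 : (fun t => inner ℝ (D (γ t)) (γ t)) =ᶠ[𝓝 0] fun _ => (1 : ℝ) := hN
    have h3 := h1.unique ((hasDerivAt_const (0 : ℝ) (1 : ℝ)).congr_of_eventuallyEq h2)
    rw [h0, hD w p, real_inner_comm (D p) w] at h3
    linarith
  · intro hw
    set c := inner ℝ (D w) w with hc
    have hpos : ∀ᶠ t : ℝ in 𝓝 0, 0 < 1 + t ^ 2 * c := by
      have : ContinuousAt (fun t : ℝ => 1 + t ^ 2 * c) 0 := by fun_prop
      exact this.eventually (lt_mem_nhds (by simp))
    -- The cross terms vanish, so the quadratic form equals `1 + t² c` on `p + t w`. Rescaling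
    -- returns the line to the quadric, and the factor has derivative zero at `t = 0`.
    refine ⟨fun t => (√(1 + t ^ 2 * c))⁻¹ • (p + t • w), ?_, by simp, ?_, ?_⟩
    · refine ContDiffAt.smul (ContDiffAt.inv (ContDiffAt.sqrt (by fun_prop) (by simp)) (by simp))
        (by fun_prop)
    · filter_upwards [hpos] with t ht
      have hp' : inner ℝ (D p) p = 1 := hp
      have hw' : inner ℝ (D w) p = 0 := by rw [hD, real_inner_comm, hw]
      simp only [quadric, Set.mem_ofPred_eq, map_smul, map_add, inner_smul_left, inner_smul_right,
        inner_add_left, inner_add_right, hp', hw, hw', ← hc, conj_trivial]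
      have := Real.mul_self_sqrt ht.le
      have hs : √(1 + t ^ 2 * c) ≠ 0 := (Real.sqrt_pos.2 ht).ne'
      field_simp
      linear_combination -this
    · have h1 : HasDerivAt (fun t : ℝ => 1 + t ^ 2 * c) 0 0 := by
        simpa using (((hasDerivAt_id (0 : ℝ)).pow 2).mul_const c).const_add 1
      have h2 : HasDerivAt (fun t : ℝ => p + t • w) w 0 := by
        simpa using ((hasDerivAt_id (0 : ℝ)).smul_const w).const_add p
      have h3 := ((h1.sqrt (by simp)).fun_inv (by simp)).fun_smul h2
      convert h3 using 1
      simp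

theorem mem_energySurface_quadric {D : V →L[ℝ] V} (hD : ∀ x y, inner ℝ (D x) y = inner ℝ x (D y))
    {κ : ℝ} {x : V × V} : x ∈ energySurface (quadric D) κ ↔
      inner ℝ (D x.1) x.1 = 1 ∧ inner ℝ (D x.1) x.2 = 0 ∧ inner ℝ x.2 x.2 = 2 * κ := by
  constructor
  · rintro ⟨⟨h1, h2⟩, h3⟩
    exact ⟨h1, (mem_tangentSpaceAt_quadric hD h1 _).1 h2, by linarith⟩
  · rintro ⟨h1, h2, h3⟩
    exact ⟨⟨h1, (mem_tangentSpaceAt_quadric hD h1 _).2 h2⟩, by linarith⟩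

/-- The differential at `x = (q, v)` of the equations `⟨Dq, q⟩ = 1`, `⟨Dq, v⟩ = 0`, `|v|² = 2κ` of
the energy surface (the first and the third halved). -/
def energyConstraint (D : V →L[ℝ] V) (x : V × V) : (V × V) →ₗ[ℝ] ℝ × ℝ × ℝ :=
  ((innerₛₗ ℝ (D x.1)).comp (LinearMap.fst ℝ V V)).prod
    (((innerₛₗ ℝ (D x.2)).comp (LinearMap.fst ℝ V V) +
      (innerₛₗ ℝ (D x.1)).comp (LinearMap.snd ℝ V V)).prod
      ((innerₛₗ ℝ x.2).comp (LinearMap.snd ℝ V V)))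

theorem mem_ker_energyConstraint {D : V →L[ℝ] V} {x ξ : V × V} :
    ξ ∈ LinearMap.ker (energyConstraint D x) ↔ inner ℝ (D x.1) ξ.1 = 0 ∧
      inner ℝ (D x.2) ξ.1 + inner ℝ (D x.1) ξ.2 = 0 ∧ inner ℝ x.2 ξ.2 = 0 := by
  simp [energyConstraint, LinearMap.mem_ker]

/-- Differentiating the three defining equations along a curve gives the constraints. This one
inclusion suffices: a family of tangent vectors on which the top form is nonzero must span the
kernel anyway. -/
theorem tangentSpaceAt_energySurface_subset {D : V →L[ℝ] V}
    (hD : ∀ x y, inner ℝ (D x) y = inner ℝ x (D y)) {κ : ℝ} {x ξ : V × V}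
    (hξ : ξ ∈ tangentSpaceAt (energySurface (quadric D) κ) x) :
    ξ ∈ LinearMap.ker (energyConstraint D x) := by
  obtain ⟨γ, -, rfl, hN, hγ⟩ := hξ
  have h1 : HasDerivAt (fun t => (γ t).1) ξ.1 0 := hγ.fst
  have h2 : HasDerivAt (fun t => (γ t).2) ξ.2 0 := hγ.snd
  have hD1 : HasDerivAt (fun t => D (γ t).1) (D ξ.1) 0 := D.hasFDerivAt.comp_hasDerivAt (0 : ℝ) h1
  have hN' := hN.mono fun t ht => (mem_energySurface_quadric hD).1 ht
  rw [mem_ker_energyConstraint]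
  refine ⟨?_, ?_, ?_⟩
  · have e : (fun t => inner ℝ (D (γ t).1) (γ t).1) =ᶠ[𝓝 0] fun _ => (1 : ℝ) :=
      hN'.mono fun t ht => ht.1
    have h := (hD1.inner ℝ h1).unique ((hasDerivAt_const _ _).congr_of_eventuallyEq e)
    rw [hD ξ.1, real_inner_comm (D _) ξ.1] at h
    linarith
  · have e : (fun t => inner ℝ (D (γ t).1) (γ t).2) =ᶠ[𝓝 0] fun _ => (0 : ℝ) :=
      hN'.mono fun t ht => ht.2.1
    have h := (hD1.inner ℝ h2).unique ((hasDerivAt_const _ _).congr_of_eventuallyEq e)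
    rw [hD ξ.1, real_inner_comm (D _) ξ.1] at h
    linarith
  · have e : (fun t => inner ℝ (γ t).2 (γ t).2) =ᶠ[𝓝 0] fun _ => 2 * κ :=
      hN'.mono fun t ht => ht.2.2
    have h := (h2.inner ℝ h2).unique ((hasDerivAt_const _ _).congr_of_eventuallyEq e)
    rw [real_inner_comm (γ 0).2 ξ.2] at h
    linarith

theorem finrank_ker_energyConstraint [FiniteDimensional ℝ V] {D : V →L[ℝ] V} {x : V × V}
    (h1 : D x.1 ≠ 0) (h2 : x.2 ≠ 0) (h : inner ℝ (D x.1) x.2 = 0) :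
    Module.finrank ℝ (LinearMap.ker (energyConstraint D x)) + 3 = 2 * Module.finrank ℝ V := by
  have h1' : inner ℝ (D x.1) (D x.1) ≠ 0 := inner_self_ne_zero.2 h1
  have h2' : inner ℝ x.2 x.2 ≠ 0 := inner_self_ne_zero.2 h2
  have hs : Function.Surjective (energyConstraint D x) := by
    rintro ⟨a, b, c⟩
    -- A triangular system: the base component along `D x.1` solves the first equation.
    -- Orthogonality of `D x.1` and `x.2` then decouples the other two.
    refine ⟨((a / inner ℝ (D x.1) (D x.1)) • D x.1,
      ((b - a / inner ℝ (D x.1) (D x.1) * inner ℝ (D x.2) (D x.1)) /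
        inner ℝ (D x.1) (D x.1)) • D x.1 + (c / inner ℝ x.2 x.2) • x.2), ?_⟩
    have h' : inner ℝ x.2 (D x.1) = 0 := by rw [real_inner_comm, h]
    simp only [energyConstraint, LinearMap.prod_apply, Function.prod_apply, LinearMap.comp_apply,
      LinearMap.add_apply, LinearMap.fst_apply, LinearMap.snd_apply, innerₛₗ_apply_apply,
      inner_add_right, inner_smul_right, h, h', mul_zero, add_zero, zero_add,
      div_mul_cancel₀ _ h1', div_mul_cancel₀ _ h2', add_sub_cancel]
  have hr := LinearMap.finrank_range_add_finrank_ker (energyConstraint D x)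
  rw [LinearMap.range_eq_top.2 hs] at hr
  simp only [finrank_top, Module.finrank_prod, Module.finrank_self] at hr
  omega

/-- The potential `½⟨J z, ·⟩`. -/
def skewPotential (J : V →L[ℝ] V) (z : V) : V →L[ℝ] ℝ :=
  (1 / 2 : ℝ) • innerSL ℝ (J z)

/-- The primitive `λ - π^*α` of the twisted symplectic form. -/
def twistedPrimitive (J : V →L[ℝ] V) : (V × V) →L[ℝ] (V × V) →L[ℝ] ℝ :=
  ((ContinuousLinearMap.compL ℝ (V × V) V ℝ).flip (ContinuousLinearMap.fst ℝ V V)).comp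
    ((innerSL ℝ).comp (ContinuousLinearMap.snd ℝ V V) -
      (1 / 2 : ℝ) • ((innerSL ℝ).comp (J.comp (ContinuousLinearMap.fst ℝ V V))))

theorem twistedPrimitive_apply (J : V →L[ℝ] V) (x ξ : V × V) :
    twistedPrimitive J x ξ = inner ℝ x.2 ξ.1 - 1 / 2 * inner ℝ (J x.1) ξ.1 := by
  simp [twistedPrimitive]

theorem extD_clm {W : Type*} [NormedAddCommGroup W] [NormedSpace ℝ W] (Λ : W →L[ℝ] W →L[ℝ] ℝ)
    (p u v : W) : extD (fun x => Λ x) p u v = Λ u v - Λ v u := by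
  rw [extD_apply Λ.differentiableAt, ContinuousLinearMap.fderiv]

/-- Both potentials are linear in the base point, so the exterior derivatives are constant; skewness
of `J` merges the two halves of `dα`. -/
theorem twistedForm_eq {J : V →L[ℝ] V} (hJ : ∀ x y, inner ℝ (J x) y = -inner ℝ x (J y))
    (x ξ η : V × V) : twistedForm (skewPotential J) x ξ η =
      inner ℝ ξ.2 η.1 - inner ℝ η.2 ξ.1 - inner ℝ (J ξ.1) η.1 := by
  have h1 : extD (liouvilleForm (V := V)) x ξ η = inner ℝ ξ.2 η.1 - inner ℝ η.2 ξ.1 := by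
    have := extD_clm (((ContinuousLinearMap.compL ℝ (V × V) V ℝ).flip
      (ContinuousLinearMap.fst ℝ V V)).comp ((innerSL ℝ).comp (ContinuousLinearMap.snd ℝ V V))) x ξ η
    exact this
  have h2 : extD (skewPotential J) x.1 ξ.1 η.1 = inner ℝ (J ξ.1) η.1 := by
    have := extD_clm ((1 / 2 : ℝ) • ((innerSL ℝ).comp J)) x.1 ξ.1 η.1
    refine Eq.trans this ?_
    simp only [smul_apply, ContinuousLinearMap.comp_apply, innerSL_apply_apply,
      smul_eq_mul]
    rw [hJ η.1, real_inner_comm (J ξ.1)]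
    ring
  rw [twistedForm, h1, h2]

theorem extD_twistedPrimitive {J : V →L[ℝ] V} (hJ : ∀ x y, inner ℝ (J x) y = -inner ℝ x (J y))
    (x ξ η : V × V) :
    extD (fun x => twistedPrimitive J x) x ξ η = twistedForm (skewPotential J) x ξ η := by
  rw [extD_clm, twistedForm_eq hJ, twistedPrimitive_apply, twistedPrimitive_apply, hJ η.1,
    real_inner_comm (J ξ.1)]
  ring

/-- The generator `(q, v) ↦ (v, Jv + μ Dq)` of the magnetic geodesic flow on the quadric. -/
def magneticField (D J : V →L[ℝ] V) (x : V × V) : V × V :=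
  (x.2, J x.2 - ((inner ℝ (D x.2) x.2 + inner ℝ (D x.1) (J x.2)) / inner ℝ (D x.1) (D x.1)) • D x.1)

/-- The normal coefficient is the one that solves the differentiated equation `⟨Dq, v⟩ = 0`. The
speed is preserved because `Jv` and `Dq` are both orthogonal to `v`. -/
theorem magneticField_mem_ker {D J : V →L[ℝ] V} (hJ : ∀ x y, inner ℝ (J x) y = -inner ℝ x (J y))
    {x : V × V} (h1 : D x.1 ≠ 0) (h : inner ℝ (D x.1) x.2 = 0) :
    magneticField D J x ∈ LinearMap.ker (energyConstraint D x) := by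
  have h1' : inner ℝ (D x.1) (D x.1) ≠ 0 := inner_self_ne_zero.2 h1
  have h3 : inner ℝ x.2 (J x.2) = 0 := by
    have := hJ x.2 x.2
    rw [real_inner_comm] at this
    linarith
  rw [mem_ker_energyConstraint]
  refine ⟨h, ?_, ?_⟩
  · simp only [magneticField, inner_sub_right, inner_smul_right, div_mul_cancel₀ _ h1']
    ring
  · simp only [magneticField, inner_sub_right, inner_smul_right, h3, real_inner_comm (D x.1) x.2, h]
    simp

/-- A contact form whose exterior derivative is the twisted symplectic form does not vanish on the
generator of the magnetic geodesic flow. -/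
theorem apply_magneticField_ne_zero [FiniteDimensional ℝ V] {D J : V →L[ℝ] V}
    (hD : ∀ x y, inner ℝ (D x) y = inner ℝ x (D y))
    (hJ : ∀ x y, inner ℝ (J x) y = -inner ℝ x (J y)) {m : ℕ}
    (hm : 2 * Module.finrank ℝ V ≤ 2 * m + 1 + 3) {κ : ℝ} (hκ : 0 < κ)
    {β : V × V → (V × V) →L[ℝ] ℝ} {p : V × V} (hp : p ∈ energySurface (quadric D) κ)
    (hβ : DifferentiableAt ℝ β p)
    (hd : ∀ u ∈ tangentSpaceAt (energySurface (quadric D) κ) p,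
      ∀ v ∈ tangentSpaceAt (energySurface (quadric D) κ) p,
      extD β p u v = twistedForm (skewPotential J) p u v)
    {w : Fin (2 * m + 1) → V × V}
    (hw : ∀ i, w i ∈ tangentSpaceAt (energySurface (quadric D) κ) p)
    (hne : wedgePow m (β p) (extD β p) w ≠ 0) : β p (magneticField D J p) ≠ 0 := by
  intro hX
  obtain ⟨e1, e2, e3⟩ := (mem_energySurface_quadric hD).1 hp
  have h1 : D p.1 ≠ 0 := by
    intro h
    rw [h, inner_zero_left] at e1
    exact zero_ne_one e1
  have h2 : p.2 ≠ 0 := by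
    intro h
    rw [h, inner_zero_left] at e3
    linarith
  let B : (V × V) →ₗ[ℝ] (V × V) →ₗ[ℝ] ℝ :=
    LinearMap.mk₂ ℝ (fun u v => fderiv ℝ β p u v - fderiv ℝ β p v u)
      (by intros; simp; ring) (by intros; simp; ring) (by intros; simp; ring)
      (by intros; simp; ring)
  have hB : extD β p = fun u v => B u v := by
    funext u v
    exact extD_apply hβ u v
  have hker := fun i => tangentSpaceAt_energySurface_subset hD (hw i)
  refine hne ?_
  rw [hB]
  refine wedgePow_eq_zero (W := LinearMap.ker (energyConstraint D p)) (fun u v => ?_) ?_ hker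
    (magneticField_mem_ker hJ h1 e2) ?_ hX ?_
  · simp only [B, LinearMap.mk₂_apply]
    ring
  · have := finrank_ker_energyConstraint h1 h2 e2
    omega
  · exact fun h => h2 (congrArg Prod.fst h)
  · intro hspan i
    have hBw : ∀ j, B (w j) (w i) = inner ℝ (w j).2 (w i).1 - inner ℝ (w i).2 (w j).1
        - inner ℝ (J (w j).1) (w i).1 := by
      intro j
      rw [← twistedForm_eq hJ p, ← hd _ (hw j) _ (hw i), hB]
    -- The identity `dβ = ω` is known only on tangent vectors such as the `w j`. Both sides are
    -- linear in `ξ`, so it extends to their span, which contains the field.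
    have hBX : ∀ ξ ∈ Submodule.span ℝ (Set.range w), B ξ (w i) =
        inner ℝ ξ.2 (w i).1 - inner ℝ (w i).2 ξ.1 - inner ℝ (J ξ.1) (w i).1 := by
      intro ξ hξ
      induction hξ using Submodule.span_induction with
      | mem x hx => obtain ⟨j, rfl⟩ := hx; exact hBw j
      | zero => simp
      | add x y _ _ hx hy =>
        simp only [map_add, LinearMap.add_apply, hx, hy, Prod.fst_add, Prod.snd_add,
          inner_add_left, inner_add_right]
        ring
      | smul c x _ hx =>
        simp only [map_smul, LinearMap.smul_apply, hx, Prod.smul_fst, Prod.smul_snd,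
          real_inner_smul_left, real_inner_smul_right, smul_eq_mul]
        ring
    obtain ⟨k1, -, k3⟩ := mem_ker_energyConstraint.1 (hker i)
    rw [hBX _ hspan]
    -- The two `J` terms cancel; what remains is a multiple of `⟨Dq, η₁⟩` and the term `⟨v, η₂⟩`,
    -- for `η = w i`, and both vanish by the constraints.
    simp only [magneticField, inner_sub_left, real_inner_smul_left, k1, real_inner_comm p.2 (w i).2, k3]
    ring

theorem continuousOn_magneticField (D J : V →L[ℝ] V) :
    ContinuousOn (magneticField D J) {x | D x.1 ≠ 0} := by
  unfold magneticField
  refine ContinuousOn.prodMk (by fun_prop) (ContinuousOn.sub (by fun_prop)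
    (ContinuousOn.smul (ContinuousOn.div (by fun_prop) (by fun_prop) ?_) (by fun_prop)))
  exact fun x hx => inner_self_ne_zero.2 hx

end Quadric

/-! ### The ellipsoid, its axis circles and the bounding discs -/

section Ellipsoid

variable {n : ℕ}

/-- The diagonal operator `A⁻¹`. -/
def diagInv (a : Fin n → ℝ) : EuclideanSpace ℂ (Fin n) →L[ℝ] EuclideanSpace ℂ (Fin n) :=
  LinearMap.toContinuousLinearMap
    { toFun := fun z => WithLp.toLp 2 fun i => (a i)⁻¹ • z i
      map_add' := fun x y => by ext i; simp
      map_smul' := fun c x => by ext i; simp [mul_left_comm] }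

theorem diagInv_apply (a : Fin n → ℝ) (z : EuclideanSpace ℂ (Fin n)) (i : Fin n) :
    diagInv a z i = (a i)⁻¹ • z i := rfl

/-- Multiplication by the imaginary unit. -/
def complexStructure (n : ℕ) : EuclideanSpace ℂ (Fin n) →L[ℝ] EuclideanSpace ℂ (Fin n) :=
  Complex.I • ContinuousLinearMap.id ℝ (EuclideanSpace ℂ (Fin n))

theorem complexStructure_apply (z : EuclideanSpace ℂ (Fin n)) :
    complexStructure n z = Complex.I • z := rfl

theorem inner_diagInv (a : Fin n → ℝ) (x y : EuclideanSpace ℂ (Fin n)) :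
    inner ℝ (diagInv a x) y = inner ℝ x (diagInv a y) := by
  simp only [PiLp.inner_apply, diagInv_apply, real_inner_smul_left, real_inner_smul_right]

theorem inner_complexStructure (x y : EuclideanSpace ℂ (Fin n)) :
    inner ℝ (complexStructure n x) y = -inner ℝ x (complexStructure n y) := by
  simp only [PiLp.inner_apply, complexStructure_apply, PiLp.smul_apply, Complex.inner,
    ← Finset.sum_neg_distrib]
  refine Finset.sum_congr rfl fun i _ => ?_
  simp
  ring

theorem ellipsoid_eq_quadric (a : Fin n → ℝ) : ellipsoid a = quadric (diagInv a) := by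
  ext z
  simp only [ellipsoid, quadric, Set.mem_ofPred_eq, PiLp.inner_apply, diagInv_apply,
    real_inner_smul_left, real_inner_self_eq_norm_sq, div_eq_inv_mul]

theorem magneticPotential_eq : (magneticPotential (n := n)) = skewPotential (complexStructure n) :=
  rfl

/-- The embedding of `ℂ²` as the coordinate plane spanned by the axes `k` and `l`. -/
def coordPlane (k l : Fin n) : ℂ × ℂ →L[ℝ] EuclideanSpace ℂ (Fin n) :=
  LinearMap.toContinuousLinearMap
    { toFun := fun x => EuclideanSpace.single k x.1 + EuclideanSpace.single l x.2
      map_add' := fun x y => by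
        ext i
        simp only [PiLp.add_apply, PiLp.single_apply, Prod.fst_add, Prod.snd_add]
        split_ifs <;> ring
      map_smul' := fun c x => by
        ext i
        simp }

theorem coordPlane_apply (k l : Fin n) (x y : ℂ) :
    coordPlane k l (x, y) = EuclideanSpace.single k x + EuclideanSpace.single l y := rfl

theorem inner_coordPlane {k l : Fin n} (hkl : k ≠ l) (x y x' y' : ℂ) :
    inner ℝ (coordPlane k l (x, y)) (coordPlane k l (x', y')) = inner ℝ x x' + inner ℝ y y' := by
  have h1 : ∀ (i j : Fin n) (z w : ℂ), inner ℝ (EuclideanSpace.single i z)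
      (EuclideanSpace.single j w) = if i = j then inner ℝ z w else (0 : ℝ) := by
    intro i j z w
    rw [PiLp.inner_apply, Finset.sum_eq_single i]
    · by_cases h : i = j <;> simp [h]
    · intro b _ hb
      simp [hb]
    · simp
  simp [coordPlane_apply, inner_add_left, inner_add_right, h1, hkl, hkl.symm]

theorem diagInv_coordPlane (a : Fin n → ℝ) (k l : Fin n) (x y : ℂ) :
    diagInv a (coordPlane k l (x, y)) = coordPlane k l ((a k)⁻¹ • x, (a l)⁻¹ • y) := by
  ext i
  simp only [diagInv_apply, coordPlane_apply, PiLp.add_apply, PiLp.single_apply, smul_add]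
  congr 1 <;> split_ifs with h <;> simp [h]

theorem complexStructure_coordPlane (k l : Fin n) (x y : ℂ) :
    complexStructure n (coordPlane k l (x, y)) = coordPlane k l (Complex.I * x, Complex.I * y) := by
  ext i
  simp only [complexStructure_apply, coordPlane_apply, PiLp.add_apply, PiLp.smul_apply,
    PiLp.single_apply, smul_add]
  congr 1 <;> split_ifs <;> simp

variable {a : Fin n → ℝ} {k l : Fin n} {κ r s : ℝ}

/-- The vectors at the points of the circle of radius `r` on the axis `k` which make the angle `φ`
with the direction of the magnetic rotation in the plane containing the axis `l`. -/
def circleFamily (k l : Fin n) (r s : ℝ) (x : ℝ × ℝ) :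
    EuclideanSpace ℂ (Fin n) × EuclideanSpace ℂ (Fin n) :=
  (coordPlane k l (r * Complex.exp (x.1 * Complex.I), 0),
    coordPlane k l ((s * Real.cos x.2 : ℝ) * (Complex.I * Complex.exp (x.1 * Complex.I)),
      (s * Real.sin x.2 : ℝ)))

theorem continuous_circleFamily (k l : Fin n) (r s : ℝ) : Continuous (circleFamily k l r s) := by
  unfold circleFamily
  fun_prop

theorem re_sq_add_im_sq_exp (t : ℝ) : (Complex.exp (t * Complex.I)).re ^ 2 +
    (Complex.exp (t * Complex.I)).im ^ 2 = 1 := by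
  rw [Complex.exp_ofReal_mul_I_re, Complex.exp_ofReal_mul_I_im, Real.cos_sq_add_sin_sq]

/-- Over axis `k` the normal `A⁻¹q` is radial, so both the rotation direction and axis `l` are
tangent. They are orthonormal, hence the speed is `s` for every angle. -/
theorem circleFamily_mem (hkl : k ≠ l) (hr : 0 < r) (hrk : a k = r ^ 2) (hs : s ^ 2 = 2 * κ)
    (x : ℝ × ℝ) : circleFamily k l r s x ∈ energySurface (quadric (diagInv a)) κ := by
  rw [mem_energySurface_quadric (inner_diagInv a)]
  have h := re_sq_add_im_sq_exp x.1
  simp only [circleFamily, diagInv_coordPlane, inner_coordPlane hkl, Complex.inner, hrk]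
  have hcs := Real.cos_sq_add_sin_sq x.2
  have hρ : (r ^ 2)⁻¹ * r ^ 2 = 1 := inv_mul_cancel₀ (by positivity)
  generalize Complex.exp (x.1 * Complex.I) = u at h
  generalize Real.cos x.2 = c at hcs
  generalize Real.sin x.2 = d at hcs
  generalize (r ^ 2)⁻¹ = ρ at hρ
  refine ⟨?_, ?_, ?_⟩
  · simp
    linear_combination ρ * r ^ 2 * h + hρ
  · simp
    ring
  · simp
    linear_combination (s ^ 2 * c ^ 2) * h + hs + s ^ 2 * hcs

theorem diagInv_circleFamily_ne_zero (hkl : k ≠ l) (hr : 0 < r) (hrk : a k = r ^ 2)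
    (x : ℝ × ℝ) : diagInv a (circleFamily k l r s x).1 ≠ 0 := by
  intro h0
  have h := ((mem_energySurface_quadric (inner_diagInv a)).1
    (circleFamily_mem (s := s) (κ := s ^ 2 / 2) hkl hr hrk (by ring) x)).1
  rw [h0, inner_zero_left] at h
  exact zero_ne_one h

/-- The velocity of the circle of radius `r` on the axis `k` with the normal velocity field of
signed length `c`. -/
def circleVelocity (k l : Fin n) (r c t : ℝ) :
    EuclideanSpace ℂ (Fin n) × EuclideanSpace ℂ (Fin n) :=
  (coordPlane k l (r * (Complex.I * Complex.exp (t * Complex.I)), 0),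
    coordPlane k l (-c * Complex.exp (t * Complex.I), 0))

/-- For `sin φ = 0` the field is tangent to the lifted circle, so the circle is a magnetic geodesic.
With `c = s cos φ`, the coefficient of the normal `A⁻¹q` is `c² - rc`, and the acceleration is the
centripetal `-(c²/r) exp(it)`. -/
theorem magneticField_circleFamily (hkl : k ≠ l) (hr : 0 < r) (hrk : a k = r ^ 2) {φ : ℝ}
    (hφ : Real.sin φ = 0) (t : ℝ) :
    magneticField (diagInv a) (complexStructure n) (circleFamily k l r s (t, φ)) =
      (s * Real.cos φ / r) • circleVelocity k l r (s * Real.cos φ) t := by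
  have h := re_sq_add_im_sq_exp t
  simp only [magneticField, circleFamily, circleVelocity, diagInv_coordPlane,
    complexStructure_coordPlane, inner_coordPlane hkl, hrk, hφ, mul_zero, Prod.smul_mk,
    ← map_smul, ← map_sub, Prod.mk_sub_mk, Complex.ofReal_zero, smul_zero, sub_zero]
  generalize s * Real.cos φ = c
  generalize Complex.exp (t * Complex.I) = u at h
  have hρ : (r ^ 2)⁻¹ * r ^ 2 = 1 := inv_mul_cancel₀ (by positivity)
  have e1 : inner ℝ ((r ^ 2)⁻¹ • (c * (Complex.I * u))) (c * (Complex.I * u)) =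
      (r ^ 2)⁻¹ * c ^ 2 := by
    generalize (r ^ 2)⁻¹ = ρ
    rw [Complex.inner]
    simp
    linear_combination ρ * c ^ 2 * h
  have e2 : inner ℝ ((r ^ 2)⁻¹ • (r * u)) (Complex.I * (c * (Complex.I * u))) =
      -((r ^ 2)⁻¹ * r * c) := by
    generalize (r ^ 2)⁻¹ = ρ
    rw [Complex.inner]
    simp
    linear_combination -ρ * r * c * h
  have e3 : inner ℝ ((r ^ 2)⁻¹ • (r * u)) ((r ^ 2)⁻¹ • (r * u)) = (r ^ 2)⁻¹ := by
    generalize (r ^ 2)⁻¹ = ρ at hρ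
    rw [Complex.inner]
    simp
    linear_combination ρ ^ 2 * r ^ 2 * h + ρ * hρ
  have hr' : (r : ℂ) ≠ 0 := by exact_mod_cast hr.ne'
  rw [e1, e2, e3]
  congr 3
  · simp
    field_simp
  · simp
    field_simp
    linear_combination (c * u * r) * Complex.I_sq

/-- A disc in the energy surface bounding the circle. -/
def discMap (k l : Fin n) (r b c : ℝ) (w : ℂ) :
    EuclideanSpace ℂ (Fin n) × EuclideanSpace ℂ (Fin n) :=
  ((1 + ‖w‖ ^ 2)⁻¹ • coordPlane k l ((2 * r) • w, ((b * (1 - ‖w‖ ^ 2) : ℝ) : ℂ)),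
    (c / √((2 * r) ^ 2 * ‖w‖ ^ 2 + (b * (1 - ‖w‖ ^ 2)) ^ 2)) •
      coordPlane k l (Complex.I * ((2 * r) • w), Complex.I * ((b * (1 - ‖w‖ ^ 2) : ℝ) : ℂ)))

/-- The two squares cannot vanish together, so the velocity normalization of `discMap` is smooth. -/
theorem disc_radius_pos {r b : ℝ} (hr : 0 < r) (hb : 0 < b) (w : ℂ) :
    0 < (2 * r) ^ 2 * ‖w‖ ^ 2 + (b * (1 - ‖w‖ ^ 2)) ^ 2 := by
  rcases eq_or_ne w 0 with rfl | hw
  · simp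
    positivity
  · have := norm_pos_iff.2 hw
    positivity

theorem contDiff_discMap (k l : Fin n) {r b : ℝ} (hr : 0 < r) (hb : 0 < b) (c : ℝ) :
    ContDiff ℝ ∞ (discMap k l r b c) := by
  have hn : ContDiff ℝ ∞ (fun w : ℂ => ‖w‖ ^ 2) := contDiff_norm_sq ℝ
  have hR : ContDiff ℝ ∞ (fun w : ℂ => ((b * (1 - ‖w‖ ^ 2) : ℝ) : ℂ)) :=
    Complex.ofRealCLM.contDiff.comp (contDiff_const.mul (contDiff_const.sub hn))
  refine ContDiff.prodMk ?_ ?_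
  · refine ContDiff.smul (ContDiff.inv (contDiff_const.add hn) fun w => by positivity)
      ((coordPlane k l).contDiff.comp (ContDiff.prodMk (by fun_prop) hR))
  · refine ContDiff.smul (ContDiff.div contDiff_const (ContDiff.sqrt ?_ fun w =>
      (disc_radius_pos hr hb w).ne') fun w => (Real.sqrt_pos.2 (disc_radius_pos hr hb w)).ne')
      ((coordPlane k l).contDiff.comp (ContDiff.prodMk (by fun_prop) (contDiff_const.mul hR)))
    exact (contDiff_const.mul hn).add ((contDiff_const.mul (contDiff_const.sub hn)).pow 2)

/-- The base point is stereographic projection, from `|2w|² + (1 - |w|²)² = (1 + |w|²)²`, stretched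
by `r` and `b`. The velocity is `c` times the unit vector along `iq`, tangent because `⟨A⁻¹q, iq⟩ =
0`. -/
theorem discMap_mem (hkl : k ≠ l) {b c : ℝ} (hr : 0 < r) (hb : 0 < b) (hrk : a k = r ^ 2)
    (hbl : a l = b ^ 2) (hc : c ^ 2 = 2 * κ) (w : ℂ) :
    discMap k l r b c w ∈ energySurface (quadric (diagInv a)) κ := by
  rw [mem_energySurface_quadric (inner_diagInv a)]
  have hM := disc_radius_pos hr hb w
  have hN : ‖w‖ ^ 2 = w.re ^ 2 + w.im ^ 2 := by
    rw [← Complex.normSq_eq_norm_sq, Complex.normSq_apply]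
    ring
  have hS := Real.sq_sqrt hM.le
  have hS0 := (Real.sqrt_pos.2 hM).ne'
  simp only [discMap, map_smul, real_inner_smul_left, real_inner_smul_right, diagInv_coordPlane,
    inner_coordPlane hkl, Complex.inner, hrk, hbl]
  have h1 : 1 + ‖w‖ ^ 2 ≠ 0 := by positivity
  generalize √((2 * r) ^ 2 * ‖w‖ ^ 2 + (b * (1 - ‖w‖ ^ 2)) ^ 2) = S at hS hS0
  generalize ‖w‖ ^ 2 = N at *
  refine ⟨?_, ?_, ?_⟩
  · simp
    field_simp
    linear_combination -4 * hN
  · simp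
    ring_nf
    simp
  · simp
    field_simp
    linear_combination S ^ 2 * hc - c ^ 2 * hS - c ^ 2 * 4 * r ^ 2 * hN

/-- On `|w| = 1` the `l`-component vanishes, so the boundary of the disc is the lifted circle; the
sign of `cos φ` selects its direction. -/
theorem discMap_exp {b : ℝ} (hr : 0 < r) {φ : ℝ} (hφ : Real.sin φ = 0) (t : ℝ) :
    discMap k l r b (s * Real.cos φ) (Complex.exp (t * Complex.I)) =
      circleFamily k l r s (t, φ) := by
  have h2 : √((2 * r) ^ 2) = 2 * r := Real.sqrt_sq (by positivity)
  have hr' : (r : ℂ) ≠ 0 := by exact_mod_cast hr.ne'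
  simp only [discMap, circleFamily, Complex.norm_exp_ofReal_mul_I, hφ, ← map_smul, Prod.smul_mk]
  norm_num [h2]
  refine ⟨?_, ?_⟩ <;> congr 2 <;> field_simp

theorem hasDerivAt_exp_ofReal_mul_I (t : ℝ) :
    HasDerivAt (fun t : ℝ => Complex.exp (t * Complex.I))
      (Complex.I * Complex.exp (t * Complex.I)) t := by
  have := ((Complex.ofRealCLM.hasDerivAt (x := t)).mul_const Complex.I).cexp
  simpa [mul_comm] using this

theorem hasDerivAt_circleFamily {φ : ℝ} (t : ℝ) :
    HasDerivAt (fun t => circleFamily k l r s (t, φ)) (circleVelocity k l r (s * Real.cos φ) t)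
      t := by
  have h1 := hasDerivAt_exp_ofReal_mul_I t
  refine HasDerivAt.prodMk ?_ ?_
  · exact (coordPlane k l).hasFDerivAt.comp_hasDerivAt t
      ((h1.const_mul (r : ℂ)).prodMk (hasDerivAt_const t (0 : ℂ)))
  · have := (coordPlane k l).hasFDerivAt.comp_hasDerivAt t
      (((h1.const_mul Complex.I).const_mul ((s * Real.cos φ : ℝ) : ℂ)).prodMk
        (hasDerivAt_const t ((s * Real.sin φ : ℝ) : ℂ)))
    convert this using 3
    · rfl
    linear_combination (-(s * Real.cos φ : ℝ) * Complex.exp (t * Complex.I)) * Complex.I_sq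

theorem twistedPrimitive_circleFamily (hkl : k ≠ l) {φ : ℝ} (hφ : Real.sin φ = 0) (t : ℝ) :
    twistedPrimitive (complexStructure n) (circleFamily k l r s (t, φ))
      (circleVelocity k l r (s * Real.cos φ) t) = s * Real.cos φ * r - r ^ 2 / 2 := by
  have h := re_sq_add_im_sq_exp t
  simp only [twistedPrimitive_apply, circleFamily, circleVelocity, complexStructure_coordPlane,
    inner_coordPlane hkl, hφ, Complex.inner]
  generalize s * Real.cos φ = c
  generalize Complex.exp (t * Complex.I) = u at h
  simp
  linear_combination (c * r - r ^ 2 / 2) * h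

/-- On each of the two circles, a primitive of the twisted form agrees somewhere with the mean
action of the circle. -/
theorem exists_apply_magneticField_eq (hkl : k ≠ l) {b : ℝ} (hr : 0 < r) (hb : 0 < b)
    (hrk : a k = r ^ 2) (hbl : a l = b ^ 2) (hs : s ^ 2 = 2 * κ) {φ : ℝ} (hφ : Real.sin φ = 0)
    {U : Set (EuclideanSpace ℂ (Fin n) × EuclideanSpace ℂ (Fin n))}
    {β : EuclideanSpace ℂ (Fin n) × EuclideanSpace ℂ (Fin n) →
      (EuclideanSpace ℂ (Fin n) × EuclideanSpace ℂ (Fin n)) →L[ℝ] ℝ} (hU : IsOpen U)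
    (hNU : energySurface (quadric (diagInv a)) κ ⊆ U) (hβ : ContDiffOn ℝ ∞ β U)
    (hd : ∀ p ∈ energySurface (quadric (diagInv a)) κ,
      ∀ u ∈ tangentSpaceAt (energySurface (quadric (diagInv a)) κ) p,
      ∀ v ∈ tangentSpaceAt (energySurface (quadric (diagInv a)) κ) p,
      extD β p u v = twistedForm (skewPotential (complexStructure n)) p u v) :
    ∃ t : ℝ, β (circleFamily k l r s (t, φ))
      (magneticField (diagInv a) (complexStructure n) (circleFamily k l r s (t, φ))) =
        s ^ 2 - s * Real.cos φ * r / 2 := by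
  have hc2 : Real.cos φ ^ 2 = 1 := by
    have := Real.cos_sq_add_sin_sq φ
    rw [hφ] at this
    linarith
  have hF := contDiff_discMap k l hr hb (s * Real.cos φ)
  obtain ⟨f, hf⟩ := exists_primitive_pullback hU hNU hβ
    (twistedPrimitive (complexStructure n)).contDiff
    (fun p hp u hu v hv => (hd p hp u hu v hv).trans
      (extD_twistedPrimitive inner_complexStructure p u v).symm) hF
    (discMap_mem hkl hr hb hrk hbl (by rw [mul_pow, hc2, mul_one, hs]))
  -- Along the boundary circle the primitive has derivative `β(γ')` minus the constant value of `λ -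
  -- π^*α` on `γ'`.
  have hg : ∀ t : ℝ, HasDerivAt (fun t : ℝ => f (Complex.exp (t * Complex.I)))
      (β (circleFamily k l r s (t, φ)) (circleVelocity k l r (s * Real.cos φ) t) -
        (s * Real.cos φ * r - r ^ 2 / 2)) t := by
    intro t
    have h1 := (hf (Complex.exp (t * Complex.I))).comp_hasDerivAt t (hasDerivAt_exp_ofReal_mul_I t)
    have h2 := ((hF.differentiable (by simp) _).hasFDerivAt).comp_hasDerivAt t (hasDerivAt_exp_ofReal_mul_I t)
    have h3 : (discMap k l r b (s * Real.cos φ) ∘ fun t : ℝ => Complex.exp (t * Complex.I)) =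
        fun t => circleFamily k l r s (t, φ) := funext fun t => discMap_exp hr hφ t
    rw [h3] at h2
    have h4 := h2.unique (hasDerivAt_circleFamily t)
    rw [ContinuousLinearMap.comp_apply, h4, discMap_exp hr hφ, sub_apply,
      twistedPrimitive_circleFamily hkl hφ] at h1
    exact h1
  -- The primitive is `2π`-periodic along the circle, so Rolle's theorem gives a point where `β(γ')`
  -- equals its mean; no integration is needed.
  obtain ⟨t, -, ht⟩ := exists_hasDerivAt_eq_zero Real.two_pi_pos
    (fun t _ => (hg t).continuousAt.continuousWithinAt) (by simp) (fun t _ => hg t)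
  refine ⟨t, ?_⟩
  rw [magneticField_circleFamily hkl hr hrk hφ, map_smul, sub_eq_zero.1 ht, smul_eq_mul]
  -- With `c = s cos φ`, the value is `(c / r)(c r - r² / 2) = c² - c r / 2`, and `c² = s²`.
  field_simp
  linear_combination 2 * s ^ 2 * hc2

end Ellipsoid

end MagneticEllipsoid

/-! ### The sign change of `β(X)` -/

open MagneticEllipsoid in
theorem mainTheorem11 (n : ℕ) (hn : 2 ≤ n) (a : Fin n → ℝ) (ha_pos : ∀ i, 0 < a i)
    (ha_mono : Monotone a) (κ : ℝ) (hκ_pos : 0 < κ) (hκ_le : κ ≤ a ⟨n - 1, by omega⟩ / 8) :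
    ¬ MagneticEllipsoid.IsOfContactType
        (MagneticEllipsoid.energySurface (MagneticEllipsoid.ellipsoid a) κ) (2 * n - 2)
        (MagneticEllipsoid.twistedForm MagneticEllipsoid.magneticPotential) := by
  rw [ellipsoid_eq_quadric, magneticPotential_eq]
  rintro ⟨U, β, hU, hNU, hβ, hd, hcontact⟩
  -- Axis `k` carries the largest circle, of radius `√a_n`; axis `l` gives room for the discs and
  -- for turning the velocity.
  set k : Fin n := ⟨n - 1, by omega⟩
  set l : Fin n := ⟨0, by omega⟩
  have hkl : k ≠ l := by
    simp only [k, l, ne_eq, Fin.mk.injEq]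
    omega
  have hr : 0 < √(a k) := Real.sqrt_pos.2 (ha_pos k)
  have hrk : a k = √(a k) ^ 2 := (Real.sq_sqrt (ha_pos k).le).symm
  have hb : 0 < √(a l) := Real.sqrt_pos.2 (ha_pos l)
  have hbl : a l = √(a l) ^ 2 := (Real.sq_sqrt (ha_pos l).le).symm
  have hs0 : 0 < √(2 * κ) := Real.sqrt_pos.2 (by linarith)
  have hs : √(2 * κ) ^ 2 = 2 * κ := Real.sq_sqrt (by linarith)
  -- This is the only use of `κ ≤ a_n / 8`, in the form `2κ ≤ a_n / 4`.
  have hsr : √(2 * κ) ≤ √(a k) / 2 := by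
    refine Real.sqrt_le_iff.2 ⟨by positivity, ?_⟩
    rw [div_pow, ← hrk]
    linarith
  generalize √(a k) = r at *
  generalize √(2 * κ) = s at *
  let h : ℝ × ℝ → ℝ := fun x => β (circleFamily k l r s x)
    (magneticField (diagInv a) (complexStructure n) (circleFamily k l r s x))
  have hmem := circleFamily_mem hkl hr hrk hs
  have hne : ∀ x, h x ≠ 0 := by
    intro x
    obtain ⟨w, hw, hww⟩ := hcontact _ (hmem x)
    refine apply_magneticField_ne_zero (inner_diagInv a) inner_complexStructure ?_ hκ_pos (hmem x)
      ((hβ.contDiffAt (hU.mem_nhds (hNU (hmem x)))).differentiableAt (by simp)) (hd _ (hmem x))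
      hw hww
    have : Module.finrank ℝ (EuclideanSpace ℂ (Fin n)) = 2 * n := by
      rw [← Module.finrank_mul_finrank ℝ ℂ (EuclideanSpace ℂ (Fin n)), Complex.finrank_real_complex,
        finrank_euclideanSpace_fin]
    -- Here `m = 2n - 2` and the real dimension is `2n`, so `2 · 2n = 2m + 1 + 3`.
    omega
  have hcont : Continuous h := by
    refine Continuous.clm_apply ?_ ?_
    · exact hβ.continuousOn.comp_continuous (continuous_circleFamily k l r s)
        fun x => hNU (hmem x)
    · exact (continuousOn_magneticField _ _).comp_continuous (continuous_circleFamily k l r s)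
        fun x => diagInv_circleFamily_ne_zero hkl hr hrk x
  obtain ⟨t₀, h₀⟩ := exists_apply_magneticField_eq hkl hr hb hrk hbl hs (φ := 0) (by simp)
    hU hNU hβ hd
  obtain ⟨t₁, h₁⟩ := exists_apply_magneticField_eq hkl hr hb hrk hbl hs (φ := Real.pi) (by simp)
    hU hNU hβ hd
  rw [Real.cos_zero] at h₀
  rw [Real.cos_pi] at h₁
  -- The value is `s (s - r / 2)`. At the threshold `s = r / 2` it is zero, which the weak
  -- inequality covers.
  have hle : h (t₀, 0) ≤ 0 := by
    refine h₀.trans_le ?_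
    nlinarith
  have hge : 0 ≤ h (t₁, Real.pi) := by
    refine le_of_le_of_eq ?_ h₁.symm
    nlinarith
  -- The parameter plane `ℝ × ℝ` is connected, so `h` takes the value zero between the two
  -- directions.
  obtain ⟨x, hx⟩ := intermediate_value_univ _ _ hcont ⟨hle, hge⟩
  exact hne x hx

end
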